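/- Let $A\in\mathbb R^{n\times n}$ be symmetric positive definite (spd) and let $\Omega^1,\dots,\Omega^N\subset\{1,\dots,n\}$ satisfy $\bigcup_s\Omega^s=\{1,\dots,n\}$. Let $n^s=\#\Omega^s$ and let $R^s\in\mathbb R^{n^s\times n}$ be the restriction matrix (the columns with index in $\Omega^s$ form the identity, the others are zero). Let $D^s\in\mathbb R^{n^s\times n^s}$ be symmetric nonsingular matrices forming a partition of unity, $\sum_{s}(R^s)^\top D^sR^s=I$; for example $D^s=R^s\big(\sum_t (R^t)^\top R^t\big)^{-1}(R^s)^\top$. Let $B^s\in\mathbb R^{n^s\times n^s}$ be symmetric matrices with $A=\sum_{s}(R^s)^\top B^sR^s$. Write $B^s=V^s\Lambda^s(V^s)^\top$ with $V^s$ orthogonal and $\Lambda^s$ diagonal, let $\Lambda^s_+$ be the diagonal matrix of the positive eigenvalues and $V^s_+$ the matrix of the corresponding columns of $V^s$, and set $$A^s_+=V^s_+\Lambda^s_+(V^s_+)^\top,\qquad A_+=\sum_{s=1}^N (R^s)^\top A^s_+R^s .$$ Let $M\in\mathbb R^{m\times m}$ be symmetric positive semi-definite, $M'\in\mathbb R^{m\times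 m}$ spd, and let $(\lambda_k,y_k)_{1\le k\le m}$ be eigenpairs of the pencil $(M,M')$: $My_k=\lambda_kM'y_k$, $\lambda_1\le\dots\le\lambda_m$, where $(y_k)$ is a basis with $\langle y_k,M'y_k\rangle=1$. For $\sigma>0$ let $Y_L(\sigma,M,M')=[y_1|\dots|y_{m_L}]$, where $m_L$ is the least $k\in\{0,\dots,m-1\}$ with $\lambda_{k+1}\ge\sigma$, and $m_L=m$ if there is none. Let $\tau_\flat>1$, and let $R^0$ be a matrix whose rows form a basis of the coarse space $$V^0=\sum_{s=1}^N\operatorname{range}\Big((R^s)^\top\,Y_L\big(\tau_\flat^{-1},\,(D^s)^{-1}A^s_+(D^s)^{-1},\,R^sA_+(R^s)^\top\big)\Big).$$ Let $\mathcal N(A_+)$ be a coloring constant for $A_+$, that is, an integer for which $\{1,\dots,N\}$ is the union of $\mathcal N(A_+)$ pairwise disjoint sets such that $R^sA_+(R^t)^\top=0$ for any two distinct elements $s,t$ of a same set. Then the matrices $R^sA_+(R^s)^\top$ and $R^0A_+(R^0)^\top$ are invertible and, with $$H=\sum_{s=1}^N (R^s)^\top\big(R^sA_+(R^s)^\top\big)^{-1}R^s,\quad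 Q=(R^0)^\top\big(R^0A_+(R^0)^\top\big)^{-1}R^0,\quad \Pi=I-QA_+,$$ $$H_{\mathrm{hyb}}=\Pi H\Pi^\top+Q,\qquad H_{\mathrm{ad}}=H+Q,$$ all eigenvalues of $H_{\mathrm{hyb}}A_+$ and $H_{\mathrm{ad}}A_+$ are real and satisfy $$\frac1{\tau_\flat}\le\lambda(H_{\mathrm{hyb}}A_+)\le\mathcal N(A_+),\qquad \frac1{(1+2\mathcal N(A_+))\,\tau_\flat}\le\lambda(H_{\mathrm{ad}}A_+)\le\mathcal N(A_+)+1 .$$ -/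

import Mathlib

open scoped Matrix

namespace AWG

/-- Restriction matrix of a subset `S` of the index set: the columns in `S` form an identity block,
the other columns vanish. Local vectors are indexed by the elements of `S`. -/
def restr {n : ℕ} (S : Finset (Fin n)) : Matrix S (Fin n) ℝ :=
  Matrix.of fun i j => if (i : Fin n) = j then 1 else 0

/-- `(D s)` is a partition of unity subordinate to the subdomains `(Ω s)`:
the sum of the `(R s)ᵀ * D s * R s` is the identity. -/
def IsPartitionOfUnity {n N : ℕ} (Ω : Fin N → Finset (Fin n))
    (D : (s : Fin N) → Matrix (Ω s) (Ω s) ℝ) : Prop :=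
  ∑ s, (restr (Ω s))ᵀ * D s * restr (Ω s) = 1

/-- The multiplicity-based choice of the partition of unity. -/
noncomputable def multPU {n N : ℕ} (Ω : Fin N → Finset (Fin n)) (s : Fin N) :
    Matrix (Ω s) (Ω s) ℝ :=
  restr (Ω s) * (∑ t, (restr (Ω t))ᵀ * restr (Ω t))⁻¹ * (restr (Ω s))ᵀ

/-- `K` is an admissible colouring constant with respect to `M`: the set of subdomains is a union of
`K` pairwise disjoint classes, and two distinct subdomains `s, t` of a same class satisfy
`R s * M * (R t)ᵀ = 0`. -/
def IsColoringConstant {n N : ℕ} (Ω : Fin N → Finset (Fin n)) (M : Matrix (Fin n) (Fin n) ℝ)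
    (K : ℕ) : Prop :=
  ∃ C : Fin K → Set (Fin N),
    (∀ i j, i ≠ j → Disjoint (C i) (C j)) ∧ (⋃ j, C j) = Set.univ ∧
    ∀ j, ∀ s ∈ C j, ∀ t ∈ C j, restr (Ω s) * M * (restr (Ω t))ᵀ = 0 ∨ s = t

/-- Positive part `V₊ * Λ₊ * V₊ᵀ` attached to a diagonalization `V * diagonal Λ * Vᵀ`, where `Λ₊` is
the diagonal matrix of the positive eigenvalues and `V₊` has the corresponding columns of `V`. -/
noncomputable def posPart {ι : Type*} [DecidableEq ι] [Fintype ι] (V : Matrix ι ι ℝ) (Λ : ι → ℝ) :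
    Matrix ι ι ℝ :=
  V.submatrix id (fun k : {k : ι // 0 < Λ k} => (k : ι)) *
    Matrix.diagonal (fun k : {k : ι // 0 < Λ k} => Λ k) *
    (V.submatrix id (fun k : {k : ι // 0 < Λ k} => (k : ι)))ᵀ

/-- The global matrix `A₊`, sum of the `(R s)ᵀ * A₊ˢ * R s`. -/
noncomputable def Apos {n N : ℕ} (Ω : Fin N → Finset (Fin n))
    (V : (s : Fin N) → Matrix (Ω s) (Ω s) ℝ) (Λ : (s : Fin N) → Ω s → ℝ) :
    Matrix (Fin n) (Fin n) ℝ :=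
  ∑ s, (restr (Ω s))ᵀ * posPart (V s) (Λ s) * restr (Ω s)

/-- `(lam k, y k)` is a full family of eigenpairs of the pencil `(MA, MB)`: the `y k` are a basis
of `MB`-normalized eigenvectors and the eigenvalues are listed in non-decreasing order. -/
structure IsPencilEigenbasis {ι : Type*} [Fintype ι] (MA MB : Matrix ι ι ℝ)
    (lam : Fin (Fintype.card ι) → ℝ) (y : Fin (Fintype.card ι) → ι → ℝ) : Prop where
  linInd : LinearIndependent ℝ y
  normalized : ∀ k, y k ⬝ᵥ (MB *ᵥ y k) = 1
  ordered : Monotone lam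
  eigen : ∀ k, MA *ᵥ y k = lam k • (MB *ᵥ y k)

open Classical in
/-- The number `m_L`: the first (zero-based) position at which the eigenvalue is at least `τ`, and
`m` if there is none. -/
noncomputable def mLow {m : ℕ} (τ : ℝ) (lam : Fin m → ℝ) : ℕ :=
  if h : ∃ k : ℕ, ∃ hk : k < m, τ ≤ lam ⟨k, hk⟩ then Nat.find h else m

/-- The matrix `Y_L = [y_1 | … | y_{m_L}]`. -/
noncomputable def YLow {ι : Type*} {m : ℕ} (τ : ℝ) (lam : Fin m → ℝ) (y : Fin m → ι → ℝ) :
    Matrix ι {k : Fin m // (k : ℕ) < mLow τ lam} ℝ :=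
  Matrix.of fun i k => y k i

/-- The GenEO coarse space: sum over the subdomains of the ranges of `(R s)ᵀ * Y_L`. -/
noncomputable def coarseSpace {n N : ℕ} (Ω : Fin N → Finset (Fin n)) (τ : ℝ)
    (lam : (s : Fin N) → Fin (Fintype.card (Ω s)) → ℝ)
    (y : (s : Fin N) → Fin (Fintype.card (Ω s)) → Ω s → ℝ) : Submodule ℝ (Fin n → ℝ) :=
  ⨆ s, LinearMap.range ((restr (Ω s))ᵀ * YLow τ (lam s) (y s)).mulVecLin

/-- The rows of `R0` are a basis of the coarse space `V0`. -/
def IsInterpolation {n n0 : ℕ} (V0 : Submodule ℝ (Fin n → ℝ)) (R0 : Matrix (Fin n0) (Fin n) ℝ) :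
    Prop :=
  LinearIndependent ℝ R0.row ∧ LinearMap.range R0ᵀ.mulVecLin = V0

/-- One-level additive Schwarz preconditioner for `M`, with exact local solvers. -/
noncomputable def HAS {n N : ℕ} (Ω : Fin N → Finset (Fin n)) (M : Matrix (Fin n) (Fin n) ℝ) :
    Matrix (Fin n) (Fin n) ℝ :=
  ∑ s, (restr (Ω s))ᵀ * (restr (Ω s) * M * (restr (Ω s))ᵀ)⁻¹ * restr (Ω s)

/-- The coarse solve `R0ᵀ * (R0 * M * R0ᵀ)⁻¹ * R0`. -/
noncomputable def coarseSolve {n n0 : ℕ} (M : Matrix (Fin n) (Fin n) ℝ)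
    (R0 : Matrix (Fin n0) (Fin n) ℝ) : Matrix (Fin n) (Fin n) ℝ :=
  R0ᵀ * (R0 * M * R0ᵀ)⁻¹ * R0

/-- The coarse projector `Π`. -/
noncomputable def coarseProj {n n0 : ℕ} (M : Matrix (Fin n) (Fin n) ℝ)
    (R0 : Matrix (Fin n0) (Fin n) ℝ) : Matrix (Fin n) (Fin n) ℝ :=
  1 - coarseSolve M R0 * M

/-- Two-level hybrid preconditioner built on the one-level preconditioner `H`. -/
noncomputable def Hhyb {n n0 : ℕ} (M : Matrix (Fin n) (Fin n) ℝ)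
    (R0 : Matrix (Fin n0) (Fin n) ℝ) (H : Matrix (Fin n) (Fin n) ℝ) :
    Matrix (Fin n) (Fin n) ℝ :=
  coarseProj M R0 * H * (coarseProj M R0)ᵀ + coarseSolve M R0

/-- Two-level additive preconditioner built on the one-level preconditioner `H`. -/
noncomputable def Had {n n0 : ℕ} (M : Matrix (Fin n) (Fin n) ℝ)
    (R0 : Matrix (Fin n0) (Fin n) ℝ) (H : Matrix (Fin n) (Fin n) ℝ) :
    Matrix (Fin n) (Fin n) ℝ :=
  H + coarseSolve M R0

/-- All (complex) eigenvalues of the real matrix `T` are real and lie in `[a, b]`. -/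
def EigenvaluesIn {n : ℕ} (T : Matrix (Fin n) (Fin n) ℝ) (a b : ℝ) : Prop :=
  spectrum ℂ (T.map (fun x : ℝ => (x : ℂ))) ⊆ (fun x : ℝ => (x : ℂ)) '' Set.Icc a b

theorem restr_transpose_mul_diagonal_mul {n : ℕ} (S : Finset (Fin n)) (d : Fin n → ℝ) :
    (restr S)ᵀ * Matrix.diagonal (fun i : S => d i) * restr S =
      Matrix.diagonal (fun i => if i ∈ S then d i else 0) := by
  ext i j
  rw [Matrix.mul_apply]
  simp only [Matrix.mul_diagonal, Matrix.transpose_apply, restr, Matrix.of_apply,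
    Matrix.diagonal_apply]
  rw [Finset.sum_coe_sort S (fun x => (if x = i then (1 : ℝ) else 0) * d x *
    (if x = j then 1 else 0))]
  by_cases hij : i = j
  · subst hij
    simp [Finset.sum_ite_eq']
  · rw [if_neg hij]
    refine Finset.sum_eq_zero fun x _ => ?_
    by_cases h : x = i
    · subst h; simp [hij]
    · simp [h]

/-- The multiplicity-based matrices are symmetric, nonsingular and form a partition of unity. -/
theorem multPU_spec {n N : ℕ} (Ω : Fin N → Finset (Fin n)) (hΩ : ∀ i, ∃ s, i ∈ Ω s) :
    IsPartitionOfUnity Ω (multPU Ω) ∧ ∀ s, (multPU Ω s).IsSymm ∧ IsUnit (multPU Ω s).det := by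
  set c : Fin n → ℝ := fun i => ∑ t, if i ∈ Ω t then (1 : ℝ) else 0 with hc
  have hcpos : ∀ i, 0 < c i := by
    intro i
    obtain ⟨s, hs⟩ := hΩ i
    refine Finset.sum_pos' (fun t _ => by split_ifs <;> norm_num) ⟨s, Finset.mem_univ _, ?_⟩
    simp [hs]
  have hsum : ∑ t, (restr (Ω t))ᵀ * restr (Ω t) = Matrix.diagonal c := by
    have : ∀ t, (restr (Ω t))ᵀ * restr (Ω t) =
        Matrix.diagonal (fun i => if i ∈ Ω t then (1 : ℝ) else 0) := by
      intro t
      have := restr_transpose_mul_diagonal_mul (Ω t) (fun _ => 1)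
      simpa using this
    simp only [this]
    ext i j
    rw [Matrix.sum_apply]
    by_cases hij : i = j
    · subst hij; simp [hc]
    · simp [hij]
  have hinv : (∑ t, (restr (Ω t))ᵀ * restr (Ω t))⁻¹ = Matrix.diagonal (fun i => (c i)⁻¹) := by
    rw [hsum]
    refine Matrix.inv_eq_right_inv ?_
    rw [Matrix.diagonal_mul_diagonal, ← Matrix.diagonal_one]
    congr 1
    ext i
    exact mul_inv_cancel₀ (hcpos i).ne'
  have hD : ∀ s, multPU Ω s = Matrix.diagonal (fun i : Ω s => (c i)⁻¹) := by
    intro s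
    rw [multPU, hinv]
    ext i j
    rw [Matrix.mul_apply]
    simp only [Matrix.mul_diagonal, restr, Matrix.transpose_apply, Matrix.of_apply,
      Matrix.diagonal_apply]
    by_cases hij : i = j
    · subst hij; simp
    · have hne : (j : Fin n) ≠ i := fun h => hij (Subtype.ext h.symm)
      simp [hij, hne]
  refine ⟨?_, fun s => ⟨?_, ?_⟩⟩
  · rw [IsPartitionOfUnity]
    simp only [hD]
    have h1 : ∀ s, (restr (Ω s))ᵀ * Matrix.diagonal (fun i : Ω s => (c i)⁻¹) * restr (Ω s) =
        Matrix.diagonal (fun i => if i ∈ Ω s then (c i)⁻¹ else 0) :=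
      fun s => restr_transpose_mul_diagonal_mul (Ω s) (fun i => (c i)⁻¹)
    simp only [h1]
    ext i j
    rw [Matrix.sum_apply]
    by_cases hij : i = j
    · subst hij
      have h2 : ∀ t, (if i ∈ Ω t then (c i)⁻¹ else 0) = (if i ∈ Ω t then (1 : ℝ) else 0) * (c i)⁻¹ := by
        intro t; split_ifs <;> simp
      simp only [Matrix.diagonal_apply_eq, Matrix.one_apply_eq, h2]
      rw [← Finset.sum_mul]
      exact mul_inv_cancel₀ (hcpos i).ne'
    · simp [hij]
  · rw [hD s]
    exact Matrix.isSymm_diagonal _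
  · rw [hD s, Matrix.det_diagonal, isUnit_iff_ne_zero]
    exact Finset.prod_ne_zero_iff.mpr fun i _ => inv_ne_zero (hcpos i).ne'

end AWG

namespace AWG

open Matrix

/-! Everything is measured in the energy inner product of A₊, which is A plus a positive
semi-definite matrix, hence spd. The preconditioned operators are self-adjoint for it, so
`eigenvaluesIn_of_form_bounds` reduces the claim to bounds on quadratic forms.

Upper bound (`form_HAS_le`): the one-level form is the sum of the energies of the local
A₊-orthogonal projections. Projections of one colour are mutually orthogonal, so each colour
contributes at most the full energy (Bessel).

Lower bound, for q in the kernel of Q A₊: the part of Dˢ Rˢ q on low eigenvectors goes to the coarse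
space, which is orthogonal to q. The rest has total local energy at most τ times that of q, because
the energy of A₊ is exactly the sum of the local energies of A₊ˢ (`exists_stable_decomposition`). A
stable splitting bounds the one-level form from below (`form_le_mul_form_HAS`).

`two_level_form_bounds` combines both through the orthogonal splitting of a vector into its coarse
projection and the remainder. -/

theorem transpose_eq_of_posDef {ι : Type*} {M : Matrix ι ι ℝ} (hM : M.PosDef) : Mᵀ = M := by
  have h := hM.isHermitian.eq
  rwa [conjTranspose_eq_transpose_of_trivial] at h

theorem transpose_eq_of_posSemidef {ι : Type*} {M : Matrix ι ι ℝ} (hM : M.PosSemidef) : Mᵀ = M := by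
  have h := hM.isHermitian.eq
  rwa [conjTranspose_eq_transpose_of_trivial] at h

/-! ### Quadratic forms and localization of the spectrum. -/

section Forms

variable {ι κ : Type*} [Fintype ι] [Fintype κ]

theorem dotProduct_mulVec_symm {M : Matrix ι ι ℝ} (hM : Mᵀ = M) (x y : ι → ℝ) :
    x ⬝ᵥ M *ᵥ y = y ⬝ᵥ M *ᵥ x := by
  rw [dotProduct_mulVec, ← mulVec_transpose, hM, dotProduct_comm]

theorem form_add {M : Matrix ι ι ℝ} (hM : Mᵀ = M) (x y : ι → ℝ) :
    (x + y) ⬝ᵥ M *ᵥ (x + y) = x ⬝ᵥ M *ᵥ x + 2 * (x ⬝ᵥ M *ᵥ y) + y ⬝ᵥ M *ᵥ y := by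
  simp only [mulVec_add, add_dotProduct, dotProduct_add]
  rw [dotProduct_mulVec_symm hM y x]
  ring

theorem form_sub {M : Matrix ι ι ℝ} (hM : Mᵀ = M) (x y : ι → ℝ) :
    (x - y) ⬝ᵥ M *ᵥ (x - y) = x ⬝ᵥ M *ᵥ x - 2 * (x ⬝ᵥ M *ᵥ y) + y ⬝ᵥ M *ᵥ y := by
  simp only [mulVec_sub, sub_dotProduct, dotProduct_sub]
  rw [dotProduct_mulVec_symm hM y x]
  ring

theorem form_transpose_mul_mul (R S : Matrix κ ι ℝ) (M : Matrix κ κ ℝ) (x y : ι → ℝ) :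
    x ⬝ᵥ (Rᵀ * M * S) *ᵥ y = (R *ᵥ x) ⬝ᵥ M *ᵥ (S *ᵥ y) := by
  rw [← mulVec_mulVec, ← mulVec_mulVec, dotProduct_mulVec, vecMul_transpose]

theorem form_sum_sum (M : Matrix ι ι ℝ) {α β : Type*} (s : Finset α) (t : Finset β)
    (f : α → ι → ℝ) (g : β → ι → ℝ) :
    (∑ i ∈ s, f i) ⬝ᵥ M *ᵥ (∑ j ∈ t, g j) = ∑ i ∈ s, ∑ j ∈ t, f i ⬝ᵥ M *ᵥ g j := by
  rw [sum_dotProduct]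
  refine Finset.sum_congr rfl fun i _ => ?_
  rw [mulVec_sum, dotProduct_sum]

theorem form_nonneg {M : Matrix ι ι ℝ} (hM : M.PosSemidef) (x : ι → ℝ) : 0 ≤ x ⬝ᵥ M *ᵥ x := by
  simpa using hM.dotProduct_mulVec_nonneg x

theorem form_pos {M : Matrix ι ι ℝ} (hM : M.PosDef) {x : ι → ℝ} (hx : x ≠ 0) :
    0 < x ⬝ᵥ M *ᵥ x := by
  simpa using hM.dotProduct_mulVec_pos hx

end Forms

/-- Rayleigh quotient bounds for `A * T` symmetric localize the complex spectrum of `T`. -/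
theorem eigenvaluesIn_of_form_bounds {n : ℕ} {A T : Matrix (Fin n) (Fin n) ℝ} (hA : A.PosDef)
    (hT : (A * T)ᵀ = A * T) {a b : ℝ}
    (hlow : ∀ x, a * (x ⬝ᵥ A *ᵥ x) ≤ x ⬝ᵥ (A * T) *ᵥ x)
    (hupp : ∀ x, x ⬝ᵥ (A * T) *ᵥ x ≤ b * (x ⬝ᵥ A *ᵥ x)) : EigenvaluesIn T a b := by
  intro μ hμ
  rw [← Matrix.spectrum_toLin', ← Module.End.hasEigenvalue_iff_mem_spectrum] at hμ
  obtain ⟨z, hz⟩ := hμ.exists_hasEigenvector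
  have hz0 := hz.2
  have hz1 := hz.apply_eq_smul
  rw [Matrix.toLin'_apply] at hz1
  set x : Fin n → ℝ := fun i => (z i).re with hx
  set y : Fin n → ℝ := fun i => (z i).im with hy
  have hTx : T *ᵥ x = μ.re • x - μ.im • y := by
    ext i
    have := congrArg Complex.re (congrFun hz1 i)
    simpa [Matrix.mulVec, dotProduct, Complex.re_sum, hx, hy] using this
  have hTy : T *ᵥ y = μ.re • y + μ.im • x := by
    ext i
    have := congrArg Complex.im (congrFun hz1 i)
    simpa [Matrix.mulVec, dotProduct, Complex.im_sum, hx, hy] using this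
  have hAs := transpose_eq_of_posDef hA
  have hxx := form_nonneg hA.posSemidef x
  have hyy := form_nonneg hA.posSemidef y
  have hpos : 0 < x ⬝ᵥ A *ᵥ x + y ⬝ᵥ A *ᵥ y := by
    by_cases h : x = 0
    · have : y ≠ 0 := by
        intro h'
        apply hz0
        ext i
        exact Complex.ext (congrFun h i) (congrFun h' i)
      linarith [form_pos hA this]
    · linarith [form_pos hA h]
  have e1 : x ⬝ᵥ (A * T) *ᵥ y = μ.re * (x ⬝ᵥ A *ᵥ y) + μ.im * (x ⬝ᵥ A *ᵥ x) := by
    rw [← mulVec_mulVec, hTy]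
    simp [mulVec_add, mulVec_smul]
  have e2 : y ⬝ᵥ (A * T) *ᵥ x = μ.re * (y ⬝ᵥ A *ᵥ x) - μ.im * (y ⬝ᵥ A *ᵥ y) := by
    rw [← mulVec_mulVec, hTx]
    simp [mulVec_sub, mulVec_smul]
  have e3 : x ⬝ᵥ (A * T) *ᵥ x = μ.re * (x ⬝ᵥ A *ᵥ x) - μ.im * (x ⬝ᵥ A *ᵥ y) := by
    rw [← mulVec_mulVec, hTx]
    simp [mulVec_sub, mulVec_smul]
  have e4 : y ⬝ᵥ (A * T) *ᵥ y = μ.re * (y ⬝ᵥ A *ᵥ y) + μ.im * (y ⬝ᵥ A *ᵥ x) := by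
    rw [← mulVec_mulVec, hTy]
    simp [mulVec_add, mulVec_smul]
  have s1 := dotProduct_mulVec_symm hAs x y
  have s2 := dotProduct_mulVec_symm hT x y
  -- Equating `e1` and `e2` by symmetry of `A * T` leaves Im μ times the positive energy of `z`.
  have him : μ.im = 0 := by
    have : μ.im * (x ⬝ᵥ A *ᵥ x + y ⬝ᵥ A *ᵥ y) = 0 := by
      rw [e1, e2, s1] at s2
      linarith
    exact (mul_eq_zero.mp this).resolve_right hpos.ne'
  have hl := add_le_add (hlow x) (hlow y)
  have hu := add_le_add (hupp x) (hupp y)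
  rw [e3, e4, him, zero_mul, zero_mul, sub_zero, add_zero, ← mul_add, ← mul_add] at hl hu
  exact ⟨μ.re, ⟨le_of_mul_le_mul_right hl hpos, le_of_mul_le_mul_right hu hpos⟩,
    Complex.ext rfl (by simp [him])⟩

theorem posDef_compress {ι κ : Type*} [Fintype ι] [Fintype κ] {A : Matrix ι ι ℝ} (hA : A.PosDef) {R : Matrix κ ι ℝ}
    (hR : Function.Injective Rᵀ.mulVec) : (R * A * Rᵀ).PosDef := by
  have := hA.conjTranspose_mul_mul_same (B := Rᵀ) hR
  simpa [conjTranspose_eq_transpose_of_trivial] using this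

/-! ### Exact solves on a subspace, local or coarse. -/

section ExactSolve

variable {ι κ : Type*} [Fintype ι] [Fintype κ] [DecidableEq κ]

/-- The solve `Rᵀ * (R * A * Rᵀ)⁻¹ * R` of `A` in the range of `Rᵀ`. -/
noncomputable def exactSolve (A : Matrix ι ι ℝ) (R : Matrix κ ι ℝ) : Matrix ι ι ℝ :=
  Rᵀ * (R * A * Rᵀ)⁻¹ * R

theorem exactSolve_transpose {A : Matrix ι ι ℝ} (hA : Aᵀ = A) (R : Matrix κ ι ℝ) :
    (exactSolve A R)ᵀ = exactSolve A R := by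
  simp [exactSolve, Matrix.transpose_mul, Matrix.transpose_nonsing_inv, hA, Matrix.mul_assoc]

theorem mul_exactSolve {A : Matrix ι ι ℝ} {R : Matrix κ ι ℝ} (h : IsUnit (R * A * Rᵀ).det) :
    R * A * exactSolve A R = R := by
  have : R * A * exactSolve A R = (R * A * Rᵀ) * (R * A * Rᵀ)⁻¹ * R := by
    simp only [exactSolve, Matrix.mul_assoc]
  rw [this, Matrix.mul_nonsing_inv _ h, Matrix.one_mul]

/-- This makes `exactSolve A R * A` idempotent; for symmetric `A` it is the `A`-orthogonal
projection onto the range of `Rᵀ`. -/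
theorem exactSolve_mul_mul {A : Matrix ι ι ℝ} {R : Matrix κ ι ℝ} (h : IsUnit (R * A * Rᵀ).det) :
    exactSolve A R * A * exactSolve A R = exactSolve A R := by
  have : exactSolve A R * A * exactSolve A R =
      Rᵀ * (R * A * Rᵀ)⁻¹ * (R * A * exactSolve A R) := by
    simp only [exactSolve, Matrix.mul_assoc]
  rw [this, mul_exactSolve h, exactSolve]

end ExactSolve

/-! ### From one-level to two-level bounds. -/

section TwoLevel

variable {n : ℕ}

/-- Bounds on the two-level forms, from an upper bound for the one-level preconditioner and a lower
bound on the `A`-orthogonal complement of the coarse space. -/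
theorem two_level_form_bounds {A E Q : Matrix (Fin n) (Fin n) ℝ} (hA : A.PosSemidef)
    (hQ : Qᵀ = Q) (hQA : Q * A * Q = Q) (hE : E.PosSemidef) {K τ : ℝ} (hK : 1 ≤ K) (hτ : 1 ≤ τ)
    (hupp : ∀ u, u ⬝ᵥ E *ᵥ u ≤ K * (u ⬝ᵥ A *ᵥ u))
    (hlow : ∀ q, Q *ᵥ A *ᵥ q = 0 → q ⬝ᵥ A *ᵥ q ≤ τ * (q ⬝ᵥ E *ᵥ q)) (u : Fin n → ℝ) :
    (1 / τ * (u ⬝ᵥ A *ᵥ u) ≤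
        ((1 - Q * A) *ᵥ u) ⬝ᵥ E *ᵥ ((1 - Q * A) *ᵥ u) + u ⬝ᵥ (A * Q * A) *ᵥ u ∧
      ((1 - Q * A) *ᵥ u) ⬝ᵥ E *ᵥ ((1 - Q * A) *ᵥ u) + u ⬝ᵥ (A * Q * A) *ᵥ u ≤
        K * (u ⬝ᵥ A *ᵥ u)) ∧
    (1 / ((1 + 2 * K) * τ) * (u ⬝ᵥ A *ᵥ u) ≤ u ⬝ᵥ E *ᵥ u + u ⬝ᵥ (A * Q * A) *ᵥ u ∧
      u ⬝ᵥ E *ᵥ u + u ⬝ᵥ (A * Q * A) *ᵥ u ≤ (K + 1) * (u ⬝ᵥ A *ᵥ u)) := by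
  have hAs := transpose_eq_of_posSemidef hA
  have hEs := transpose_eq_of_posSemidef hE
  set p := (Q * A) *ᵥ u with hp
  set q := (1 - Q * A) *ᵥ u with hq
  have hu : u = p + q := by simp [hp, hq, sub_mulVec]
  have hqu : q = u - p := by simp [hp, hq, sub_mulVec]
  have hq0 : Q *ᵥ A *ᵥ q = 0 := by
    rw [hq, mulVec_mulVec, mulVec_mulVec, Matrix.mul_sub, Matrix.mul_one, ← Matrix.mul_assoc, hQA,
      sub_self, zero_mulVec]
  have hpp : u ⬝ᵥ (A * Q * A) *ᵥ u = p ⬝ᵥ A *ᵥ p := by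
    have : A * Q * A = (Q * A)ᵀ * A * (Q * A) := by
      rw [Matrix.transpose_mul, hQ, hAs, ← hQA]
      simp only [Matrix.mul_assoc]
      simp only [← Matrix.mul_assoc, hQA]
    rw [this, form_transpose_mul_mul]
  have hpq : p ⬝ᵥ A *ᵥ q = 0 := by
    rw [hp, ← mulVec_mulVec, dotProduct_comm, dotProduct_mulVec, ← mulVec_transpose, hQ, hq0,
      zero_dotProduct]
  have huu : u ⬝ᵥ A *ᵥ u = p ⬝ᵥ A *ᵥ p + q ⬝ᵥ A *ᵥ q := by
    conv_lhs => rw [hu, form_add hAs, hpq]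
    ring
  -- The additive method applies `E` to `u`, not to `q = u - p`; the parallelogram inequality used
  -- here is the source of the factor `1 + 2 * K`.
  have hEq : q ⬝ᵥ E *ᵥ q ≤ 2 * (u ⬝ᵥ E *ᵥ u) + 2 * (p ⬝ᵥ E *ᵥ p) := by
    have h1 := form_nonneg hE (u + p)
    have h2 := form_sub hEs u p
    rw [form_add hEs] at h1
    rw [hqu]
    linarith
  have hp0 := form_nonneg hA p
  have hqn := form_nonneg hA q
  have hEu := form_nonneg hE u
  have l1 := hlow q hq0
  have u1 := hupp q
  have u2 := hupp p
  have u3 := hupp u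
  have hτ0 : 0 < τ := by linarith
  rw [hpp]
  refine ⟨⟨?_, ?_⟩, ?_, ?_⟩
  -- The coarse energy enters with coefficient one: `1 ≤ τ` absorbs it here, and `1 ≤ K` in the next
  -- bound.
  · rw [one_div_mul_eq_div, div_le_iff₀ hτ0, huu]
    nlinarith
  · rw [huu]
    nlinarith
  · rw [one_div_mul_eq_div, div_le_iff₀ (by positivity), huu]
    have h1 : τ * (q ⬝ᵥ E *ᵥ q) ≤ τ * (2 * (u ⬝ᵥ E *ᵥ u) + 2 * (K * (p ⬝ᵥ A *ᵥ p))) :=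
      mul_le_mul_of_nonneg_left (by linarith) hτ0.le
    have h2 : 0 ≤ τ * (u ⬝ᵥ E *ᵥ u) * (2 * K - 1) :=
      mul_nonneg (mul_nonneg hτ0.le hEu) (by linarith)
    have h3 : 0 ≤ (τ - 1) * (p ⬝ᵥ A *ᵥ p) := mul_nonneg (by linarith) hp0
    linarith
  · nlinarith

end TwoLevel

/-! ### One-level additive Schwarz. -/

section Schwarz

variable {n N : ℕ}

theorem restr_transpose_mulVec_apply (S : Finset (Fin n)) (z : S → ℝ) (i : S) :
    ((restr S)ᵀ *ᵥ z) i = z i := by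
  simp only [mulVec, dotProduct, transpose_apply, restr, of_apply]
  rw [Finset.sum_eq_single i]
  · simp
  · intro j _ hj
    simp [Subtype.coe_injective.ne hj]
  · simp

theorem restr_transpose_mulVec_injective (S : Finset (Fin n)) :
    Function.Injective (restr S)ᵀ.mulVec := by
  intro z w h
  ext i
  rw [← restr_transpose_mulVec_apply S z i, ← restr_transpose_mulVec_apply S w i, h]

/-- The form is the energy of an orthogonal projection of `u`. -/
theorem form_exactSolve {κ : Type*} [Fintype κ] [DecidableEq κ] {A : Matrix (Fin n) (Fin n) ℝ}
    (hA : Aᵀ = A) {R : Matrix κ (Fin n) ℝ} (h : IsUnit (R * A * Rᵀ).det) (u : Fin n → ℝ) :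
    u ⬝ᵥ (A * exactSolve A R * A) *ᵥ u =
      ((exactSolve A R * A) *ᵥ u) ⬝ᵥ A *ᵥ ((exactSolve A R * A) *ᵥ u) := by
  rw [← form_transpose_mul_mul]
  congr 2
  rw [Matrix.transpose_mul, exactSolve_transpose hA, hA]
  conv_lhs => rw [← exactSolve_mul_mul h]
  simp only [Matrix.mul_assoc]

theorem form_HAS (Ω : Fin N → Finset (Fin n)) (A : Matrix (Fin n) (Fin n) ℝ) (u : Fin n → ℝ) :
    u ⬝ᵥ (A * HAS Ω A * A) *ᵥ u = ∑ s, u ⬝ᵥ (A * exactSolve A (restr (Ω s)) * A) *ᵥ u := by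
  have : A * HAS Ω A * A = ∑ s, A * exactSolve A (restr (Ω s)) * A := by
    simp only [HAS, exactSolve, Matrix.mul_sum, Matrix.sum_mul]
  rw [this, sum_mulVec, dotProduct_sum]

theorem HAS_transpose (Ω : Fin N → Finset (Fin n)) {A : Matrix (Fin n) (Fin n) ℝ} (hA : Aᵀ = A) :
    (HAS Ω A)ᵀ = HAS Ω A := by
  rw [HAS, Matrix.transpose_sum]
  exact Finset.sum_congr rfl fun s _ => exactSolve_transpose hA _

theorem posSemidef_mul_HAS_mul (Ω : Fin N → Finset (Fin n)) {A : Matrix (Fin n) (Fin n) ℝ}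
    (hA : A.PosDef) : (A * HAS Ω A * A).PosSemidef := by
  have hAs := transpose_eq_of_posDef hA
  refine Matrix.PosSemidef.of_dotProduct_mulVec_nonneg ?_ fun u => ?_
  · rw [IsHermitian, conjTranspose_eq_transpose_of_trivial, Matrix.transpose_mul,
      Matrix.transpose_mul, hAs, HAS_transpose Ω hAs, Matrix.mul_assoc]
  · rw [star_trivial, form_HAS]
    refine Finset.sum_nonneg fun s _ => ?_
    rw [form_exactSolve hAs
      (posDef_compress hA (restr_transpose_mulVec_injective _)).det_pos.ne'.isUnit]
    exact form_nonneg hA.posSemidef _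

/-- The coloring bound for the one-level preconditioner. -/
theorem form_HAS_le (Ω : Fin N → Finset (Fin n)) {A : Matrix (Fin n) (Fin n) ℝ}
    (hA : A.PosDef) {K : ℕ} (hK : IsColoringConstant Ω A K) (u : Fin n → ℝ) :
    u ⬝ᵥ (A * HAS Ω A * A) *ᵥ u ≤ K * (u ⬝ᵥ A *ᵥ u) := by
  classical
  obtain ⟨C, -, hcov, hC⟩ := hK
  have hAs := transpose_eq_of_posDef hA
  have hunit : ∀ s, IsUnit (restr (Ω s) * A * (restr (Ω s))ᵀ).det := fun s =>
    (posDef_compress hA (restr_transpose_mulVec_injective _)).det_pos.ne'.isUnit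
  set P : Fin N → Fin n → ℝ := fun s => (exactSolve A (restr (Ω s)) * A) *ᵥ u with hP
  set f : Fin N → ℝ := fun s => P s ⬝ᵥ A *ᵥ P s with hf
  have hfu : ∀ s, u ⬝ᵥ A *ᵥ P s = f s := fun s => by
    simp only [hf, hP]
    rw [← form_exactSolve hAs (hunit s), mulVec_mulVec, Matrix.mul_assoc]
  have hf0 : ∀ s, 0 ≤ f s := fun s => form_nonneg hA.posSemidef _
  have horth : ∀ s t, restr (Ω s) * A * (restr (Ω t))ᵀ = 0 → P s ⬝ᵥ A *ᵥ P t = 0 := by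
    intro s t h
    have h1 : exactSolve A (restr (Ω s)) * A * exactSolve A (restr (Ω t)) =
        (restr (Ω s))ᵀ * (restr (Ω s) * A * (restr (Ω s))ᵀ)⁻¹ *
          (restr (Ω s) * A * (restr (Ω t))ᵀ) * (restr (Ω t) * A * (restr (Ω t))ᵀ)⁻¹ *
            restr (Ω t) := by
      simp only [exactSolve, Matrix.mul_assoc]
    rw [h, Matrix.mul_zero, Matrix.zero_mul, Matrix.zero_mul] at h1
    have h2 : (exactSolve A (restr (Ω s)) * A)ᵀ * A * (exactSolve A (restr (Ω t)) * A) =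
        A * (exactSolve A (restr (Ω s)) * A * exactSolve A (restr (Ω t))) * A := by
      rw [Matrix.transpose_mul, exactSolve_transpose hAs, hAs]
      simp only [Matrix.mul_assoc]
    simp only [hP]
    rw [← form_transpose_mul_mul, h2, h1]
    simp
  have hclass : ∀ j, ∑ s with s ∈ C j, f s ≤ u ⬝ᵥ A *ᵥ u := by
    intro j
    set w := ∑ s with s ∈ C j, P s with hw
    have h1 : u ⬝ᵥ A *ᵥ w = ∑ s with s ∈ C j, f s := by
      rw [hw, mulVec_sum, dotProduct_sum]
      exact Finset.sum_congr rfl fun s _ => hfu s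
    have h2 : w ⬝ᵥ A *ᵥ w = ∑ s with s ∈ C j, f s := by
      rw [hw, form_sum_sum]
      refine Finset.sum_congr rfl fun s hs => ?_
      refine Finset.sum_eq_single_of_mem s hs fun t ht hts => ?_
      exact horth s t ((hC j s (by simpa using hs) t (by simpa using ht)).resolve_right hts.symm)
    -- Bessel's inequality: `h1` and `h2` give `w` the same energy as its product with `u`.
    have h3 := form_nonneg hA.posSemidef (u - w)
    rw [form_sub hAs, h1, h2] at h3
    linarith
  have hsum : ∑ s, f s ≤ ∑ j, ∑ s with s ∈ C j, f s := by
    simp only [Finset.sum_filter]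
    rw [Finset.sum_comm]
    refine Finset.sum_le_sum fun s _ => ?_
    obtain ⟨j, hj⟩ := Set.mem_iUnion.mp (hcov ▸ Set.mem_univ s : s ∈ ⋃ j, C j)
    calc f s = if s ∈ C j then f s else 0 := by rw [if_pos hj]
      _ ≤ _ := Finset.single_le_sum (f := fun j => if s ∈ C j then f s else 0)
        (fun i _ => by split_ifs; exacts [hf0 s, le_rfl]) (Finset.mem_univ j)
  rw [form_HAS]
  calc ∑ s, u ⬝ᵥ (A * exactSolve A (restr (Ω s)) * A) *ᵥ u = ∑ s, f s :=
        Finset.sum_congr rfl fun s _ => form_exactSolve hAs (hunit s) u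
    _ ≤ _ := hsum
    _ ≤ ∑ _j : Fin K, u ⬝ᵥ A *ᵥ u := Finset.sum_le_sum fun j _ => hclass j
    _ = _ := by simp

/-- The one-level preconditioner is bounded below at `q` as soon as `q` has a stable decomposition
up to a component that is `A`-orthogonal to `q`. -/
theorem form_le_mul_form_HAS (Ω : Fin N → Finset (Fin n)) {A : Matrix (Fin n) (Fin n) ℝ}
    (hA : A.PosDef) {τ : ℝ} (hτ : 0 < τ) {q x : Fin n → ℝ} {z : (s : Fin N) → Ω s → ℝ}
    (hx : x ⬝ᵥ A *ᵥ q = 0) (hq : q = x + ∑ s, (restr (Ω s))ᵀ *ᵥ z s)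
    (hz : ∑ s, z s ⬝ᵥ (restr (Ω s) * A * (restr (Ω s))ᵀ) *ᵥ z s ≤ τ * (q ⬝ᵥ A *ᵥ q)) :
    q ⬝ᵥ A *ᵥ q ≤ τ * (q ⬝ᵥ (A * HAS Ω A * A) *ᵥ q) := by
  have hAs := transpose_eq_of_posDef hA
  have hunit : ∀ s, IsUnit (restr (Ω s) * A * (restr (Ω s))ᵀ).det := fun s =>
    (posDef_compress hA (restr_transpose_mulVec_injective _)).det_pos.ne'.isUnit
  have hqq : q ⬝ᵥ A *ᵥ q = ∑ s, ((restr (Ω s))ᵀ *ᵥ z s) ⬝ᵥ A *ᵥ q := by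
    conv_lhs => rw [hq, add_dotProduct, sum_dotProduct, ← hq, hx, zero_add]
  have hterm : ∀ s, 2 * τ * (((restr (Ω s))ᵀ *ᵥ z s) ⬝ᵥ A *ᵥ q) ≤
      τ ^ 2 * (q ⬝ᵥ (A * exactSolve A (restr (Ω s)) * A) *ᵥ q) +
        z s ⬝ᵥ (restr (Ω s) * A * (restr (Ω s))ᵀ) *ᵥ z s := by
    intro s
    set r := (restr (Ω s))ᵀ *ᵥ z s with hr
    set P := (exactSolve A (restr (Ω s)) * A) *ᵥ q with hP
    have h1 : r ⬝ᵥ A *ᵥ q = P ⬝ᵥ A *ᵥ r := by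
      rw [dotProduct_mulVec_symm hAs P r, hr, hP, mulVec_transpose, ← dotProduct_mulVec,
        ← dotProduct_mulVec, mulVec_mulVec, mulVec_mulVec, mulVec_mulVec, ← Matrix.mul_assoc,
        mul_exactSolve (hunit s)]
    have h2 : z s ⬝ᵥ (restr (Ω s) * A * (restr (Ω s))ᵀ) *ᵥ z s = r ⬝ᵥ A *ᵥ r := by
      have := form_transpose_mul_mul (restr (Ω s))ᵀ (restr (Ω s))ᵀ A (z s) (z s)
      rwa [Matrix.transpose_transpose] at this
    -- Young's inequality with weight `τ`: after summation, `hz` bounds the `z` terms by `τ` times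
    -- the energy of `q`, half of the left-hand side.
    have h3 := form_nonneg hA.posSemidef (τ • P - r)
    rw [form_sub hAs] at h3
    simp only [mulVec_smul, smul_dotProduct, dotProduct_smul, smul_eq_mul] at h3
    rw [form_exactSolve hAs (hunit s), h2, h1]
    linarith
  have hsum := Finset.sum_le_sum fun s (_ : s ∈ Finset.univ) => hterm s
  rw [← Finset.mul_sum, ← hqq, Finset.sum_add_distrib, ← Finset.mul_sum, ← form_HAS] at hsum
  have : τ * (q ⬝ᵥ A *ᵥ q) ≤ τ * (τ * (q ⬝ᵥ (A * HAS Ω A * A) *ᵥ q)) := by linarith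
  exact le_of_mul_le_mul_left this hτ

end Schwarz

/-! ### Spectral splitting for a matrix pencil. -/

section Pencil

theorem lt_of_lt_mLow {m : ℕ} {τ : ℝ} {lam : Fin m → ℝ} {k : Fin m} (hk : (k : ℕ) < mLow τ lam) :
    lam k < τ := by
  classical
  unfold mLow at hk
  split_ifs at hk with h
  · have := Nat.find_min h hk
    by_contra! hc
    exact this ⟨k.2, hc⟩
  · by_contra! hc
    exact h ⟨k, k.2, hc⟩

theorem le_of_mLow_le {m : ℕ} {τ : ℝ} {lam : Fin m → ℝ} (hlam : Monotone lam) {k : Fin m}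
    (hk : mLow τ lam ≤ k) : τ ≤ lam k := by
  classical
  unfold mLow at hk
  split_ifs at hk with h
  · obtain ⟨h1, h2⟩ := Nat.find_spec h
    exact h2.trans (hlam hk)
  · exact absurd k.2 (by omega)

variable {ι : Type*} [Fintype ι] {MA MB : Matrix ι ι ℝ} {lam : Fin (Fintype.card ι) → ℝ}
  {y : Fin (Fintype.card ι) → ι → ℝ}

/-- Eigenvectors sharing an eigenvalue need not be orthogonal, so only distinct eigenvalues are
covered. -/
theorem IsPencilEigenbasis.orthogonal (h : IsPencilEigenbasis MA MB lam y) (hMA : MAᵀ = MA)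
    (hMB : MBᵀ = MB) {j k : Fin (Fintype.card ι)} (hjk : lam j ≠ lam k) :
    y j ⬝ᵥ MB *ᵥ y k = 0 := by
  have h1 := dotProduct_mulVec_symm hMA (y j) (y k)
  rw [h.eigen, h.eigen, dotProduct_smul, dotProduct_smul, dotProduct_mulVec_symm hMB (y k) (y j),
    smul_eq_mul, smul_eq_mul] at h1
  have : (lam j - lam k) * (y j ⬝ᵥ MB *ᵥ y k) = 0 := by linarith
  exact (mul_eq_zero.mp this).resolve_left (sub_ne_zero.mpr hjk)

/-- On a span of eigenvectors with eigenvalues at least `σ`, the form of `MA` dominates `σ` times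
the form of `MB`. -/
theorem IsPencilEigenbasis.le_form_sum (h : IsPencilEigenbasis MA MB lam y) (hMA : MAᵀ = MA)
    (hMB : MB.PosSemidef) {σ : ℝ} (s : Finset (Fin (Fintype.card ι))) (hs : ∀ k ∈ s, σ ≤ lam k)
    (c : Fin (Fintype.card ι) → ℝ) :
    σ * ((∑ k ∈ s, c k • y k) ⬝ᵥ MB *ᵥ (∑ k ∈ s, c k • y k)) ≤
      (∑ k ∈ s, c k • y k) ⬝ᵥ MA *ᵥ (∑ k ∈ s, c k • y k) := by
  -- The rescaled vector has `MB`-form equal to the difference of the two sides: pairs with equal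
  -- eigenvalues multiply their square roots to `lam k - σ`, all other pairs vanish. No
  -- orthogonality inside an eigenspace is required.
  have h0 := form_nonneg hMB (∑ k ∈ s, (√(lam k - σ) * c k) • y k)
  have hMBs := transpose_eq_of_posSemidef hMB
  rw [form_sum_sum] at h0
  rw [form_sum_sum, form_sum_sum, ← sub_nonneg, Finset.mul_sum, ← Finset.sum_sub_distrib]
  refine h0.trans_eq (Finset.sum_congr rfl fun j hj => ?_)
  rw [Finset.mul_sum, ← Finset.sum_sub_distrib]
  refine Finset.sum_congr rfl fun k hk => ?_
  simp only [mulVec_smul, smul_dotProduct, dotProduct_smul, smul_eq_mul, h.eigen]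
  by_cases hjk : lam j = lam k
  · rw [hjk]
    have := Real.mul_self_sqrt (sub_nonneg.mpr (hs k hk))
    linear_combination c k * c j * (y j ⬝ᵥ MB *ᵥ y k) * this
  · rw [h.orthogonal hMA hMBs hjk]
    ring

/-- Splitting of a vector along the low and the high eigenvectors of a pencil. -/
theorem IsPencilEigenbasis.exists_low_high (h : IsPencilEigenbasis MA MB lam y)
    (hMA : MA.PosSemidef) (hMB : MB.PosSemidef) (σ : ℝ) (v : ι → ℝ) :
    ∃ (c : {k : Fin (Fintype.card ι) // (k : ℕ) < mLow σ lam} → ℝ) (z : ι → ℝ),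
      v = YLow σ lam y *ᵥ c + z ∧ σ * (z ⬝ᵥ MB *ᵥ z) ≤ v ⬝ᵥ MA *ᵥ v := by
  have hMAs := transpose_eq_of_posSemidef hMA
  have hMBs := transpose_eq_of_posSemidef hMB
  have hspan := h.linInd.span_eq_top_of_card_eq_finrank' (by simp)
  obtain ⟨d, hd⟩ := (Submodule.mem_span_range_iff_exists_fun ℝ).mp
    (hspan ▸ Submodule.mem_top : v ∈ Submodule.span ℝ (Set.range y))
  set L : Finset (Fin (Fintype.card ι)) := {k | (k : ℕ) < mLow σ lam} with hL
  set p := ∑ k ∈ L, d k • y k with hp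
  set z := ∑ k ∈ Lᶜ, d k • y k with hz
  have hv : v = p + z := by rw [← hd, hp, hz, Finset.sum_add_sum_compl]
  have hhigh : ∀ k ∈ Lᶜ, σ ≤ lam k := fun k hk => le_of_mLow_le h.ordered (by simpa [hL] using hk)
  refine ⟨fun k => d k, z, ?_, ?_⟩
  · rw [hv]
    congr 1
    ext i
    simp only [hp, Finset.sum_apply, Pi.smul_apply, smul_eq_mul, mulVec, dotProduct, YLow, of_apply]
    rw [Finset.sum_subtype L (p := fun k : Fin (Fintype.card ι) => (k : ℕ) < mLow σ lam) (by simp [hL])]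
    exact Finset.sum_congr rfl fun k _ => mul_comm _ _
  · have hpz : p ⬝ᵥ MA *ᵥ z = 0 := by
      rw [hp, hz, form_sum_sum]
      refine Finset.sum_eq_zero fun j hj => Finset.sum_eq_zero fun k hk => ?_
      -- Low and high eigenvalues are separated by `σ`, hence distinct, which kills the cross terms.
      have h1 : lam j < σ := lt_of_lt_mLow (by simpa [hL] using hj)
      simp [mulVec_smul, h.eigen, h.orthogonal hMAs hMBs (h1.trans_le (hhigh k hk)).ne]
    have h2 := h.le_form_sum hMAs hMB Lᶜ hhigh d
    have h3 := form_nonneg hMA p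
    rw [hv, form_add hMAs, hpz]
    linarith

end Pencil

/-! ### Positive parts and definiteness of A₊. -/

section PosPart

variable {ι : Type*} [DecidableEq ι] [Fintype ι]

theorem posPart_eq (V : Matrix ι ι ℝ) (Λ : ι → ℝ) :
    posPart V Λ = V * diagonal (fun k => max (Λ k) 0) * Vᵀ := by
  ext i j
  rw [posPart, Matrix.mul_apply, Matrix.mul_apply]
  simp only [mul_diagonal, submatrix_apply, transpose_apply, id_eq]
  rw [← Finset.sum_subtype (Finset.univ.filter fun k => 0 < Λ k) (by simp)
    (fun k => V i k * Λ k * V j k), Finset.sum_filter]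
  refine Finset.sum_congr rfl fun k _ => ?_
  split_ifs with h
  · rw [max_eq_left h.le]
  · rw [max_eq_right (not_lt.mp h)]
    ring

theorem posSemidef_mul_diagonal_mul_transpose (V : Matrix ι ι ℝ) {d : ι → ℝ} (hd : ∀ k, 0 ≤ d k) :
    (V * diagonal d * Vᵀ).PosSemidef := by
  have := (PosSemidef.diagonal (d := d) hd).mul_mul_conjTranspose_same V
  rwa [conjTranspose_eq_transpose_of_trivial] at this

theorem posPart_posSemidef (V : Matrix ι ι ℝ) (Λ : ι → ℝ) : (posPart V Λ).PosSemidef := by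
  rw [posPart_eq]
  exact posSemidef_mul_diagonal_mul_transpose V fun k => le_max_right _ _

theorem posPart_sub_posSemidef (V : Matrix ι ι ℝ) (Λ : ι → ℝ) :
    (posPart V Λ - V * diagonal Λ * Vᵀ).PosSemidef := by
  have : posPart V Λ - V * diagonal Λ * Vᵀ = V * diagonal (fun k => max (Λ k) 0 - Λ k) * Vᵀ := by
    rw [posPart_eq, ← Matrix.sub_mul, ← Matrix.mul_sub, diagonal_sub]
  rw [this]
  exact posSemidef_mul_diagonal_mul_transpose V fun k => sub_nonneg.mpr (le_max_left _ _)

variable {n N : ℕ}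

theorem posSemidef_sum_restr (Ω : Fin N → Finset (Fin n)) {M : (s : Fin N) → Matrix (Ω s) (Ω s) ℝ}
    (hM : ∀ s, (M s).PosSemidef) : (∑ s, (restr (Ω s))ᵀ * M s * restr (Ω s)).PosSemidef :=
  Matrix.posSemidef_sum _ fun s _ => by
    have := (hM s).conjTranspose_mul_mul_same (restr (Ω s))
    rwa [conjTranspose_eq_transpose_of_trivial] at this

/-- Replacing each local matrix by its positive part adds a positive semi-definite matrix to an spd
one. -/
theorem Apos_posDef (Ω : Fin N → Finset (Fin n)) (V : (s : Fin N) → Matrix (Ω s) (Ω s) ℝ)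
    (Λ : (s : Fin N) → Ω s → ℝ)
    (hA : (∑ s, (restr (Ω s))ᵀ * (V s * diagonal (Λ s) * (V s)ᵀ) * restr (Ω s)).PosDef) :
    (Apos Ω V Λ).PosDef := by
  have := hA.add_posSemidef
    (posSemidef_sum_restr Ω fun s => posPart_sub_posSemidef (V s) (Λ s))
  rw [← Finset.sum_add_distrib] at this
  convert this using 1
  refine Finset.sum_congr rfl fun s _ => ?_
  rw [← Matrix.add_mul, ← Matrix.mul_add, add_sub_cancel]

end PosPart

/-! ### Stable decomposition and the coarse space. -/

section StableDecomposition

variable {n N : ℕ}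

/-- The GenEO coarse space and the partition of unity provide a stable decomposition. -/
theorem exists_stable_decomposition (Ω : Fin N → Finset (Fin n))
    {D : (s : Fin N) → Matrix (Ω s) (Ω s) ℝ} (hD : IsPartitionOfUnity Ω D)
    (hDsymm : ∀ s, (D s).IsSymm) (hDinv : ∀ s, IsUnit (D s).det)
    (V : (s : Fin N) → Matrix (Ω s) (Ω s) ℝ) (Λ : (s : Fin N) → Ω s → ℝ)
    (hA : (Apos Ω V Λ).PosDef) {τ : ℝ} (hτ : 0 < τ)
    {lam : (s : Fin N) → Fin (Fintype.card (Ω s)) → ℝ}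
    {y : (s : Fin N) → Fin (Fintype.card (Ω s)) → Ω s → ℝ}
    (hy : ∀ s, IsPencilEigenbasis ((D s)⁻¹ * posPart (V s) (Λ s) * (D s)⁻¹)
      (restr (Ω s) * Apos Ω V Λ * (restr (Ω s))ᵀ) (lam s) (y s)) (u : Fin n → ℝ) :
    ∃ x ∈ coarseSpace Ω τ⁻¹ lam y, ∃ z : (s : Fin N) → Ω s → ℝ,
      u = x + ∑ s, (restr (Ω s))ᵀ *ᵥ z s ∧
      ∑ s, z s ⬝ᵥ (restr (Ω s) * Apos Ω V Λ * (restr (Ω s))ᵀ) *ᵥ z s ≤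
        τ * (u ⬝ᵥ Apos Ω V Λ *ᵥ u) := by
  have hDi : ∀ s, ((D s)⁻¹)ᵀ = (D s)⁻¹ := fun s => by
    rw [Matrix.transpose_nonsing_inv, (hDsymm s).eq]
  have hMA : ∀ s, ((D s)⁻¹ * posPart (V s) (Λ s) * (D s)⁻¹).PosSemidef := fun s => by
    have := (posPart_posSemidef (V s) (Λ s)).conjTranspose_mul_mul_same (D s)⁻¹
    rwa [conjTranspose_eq_transpose_of_trivial, hDi] at this
  have hMB : ∀ s, (restr (Ω s) * Apos Ω V Λ * (restr (Ω s))ᵀ).PosSemidef := fun s =>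
    (posDef_compress hA (restr_transpose_mulVec_injective _)).posSemidef
  -- With the weight `D s` in the split vector, the factors `(D s)⁻¹` of the pencil cancel and leave
  -- the local energy of `restr (Ω s) *ᵥ u`.
  choose c z hcz hz using fun s =>
    (hy s).exists_low_high (hMA s) (hMB s) τ⁻¹ (D s *ᵥ restr (Ω s) *ᵥ u)
  refine ⟨∑ s, ((restr (Ω s))ᵀ * YLow τ⁻¹ (lam s) (y s)) *ᵥ c s, ?_, z, ?_, ?_⟩
  · exact Submodule.sum_mem _ fun s _ => Submodule.mem_iSup_of_mem s ⟨c s, rfl⟩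
  · have h1 : u = ∑ s, (restr (Ω s))ᵀ *ᵥ D s *ᵥ restr (Ω s) *ᵥ u := by
      conv_lhs => rw [← one_mulVec u, ← hD, sum_mulVec]
      simp only [mulVec_mulVec, Matrix.mul_assoc]
    rw [← Finset.sum_add_distrib]
    conv_lhs => rw [h1]
    refine Finset.sum_congr rfl fun s _ => ?_
    rw [hcz s, mulVec_add, mulVec_mulVec]
  · have h2 : u ⬝ᵥ Apos Ω V Λ *ᵥ u =
        ∑ s, (restr (Ω s) *ᵥ u) ⬝ᵥ posPart (V s) (Λ s) *ᵥ (restr (Ω s) *ᵥ u) := by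
      rw [Apos, sum_mulVec, dotProduct_sum]
      exact Finset.sum_congr rfl fun s _ => form_transpose_mul_mul _ _ _ _ _
    rw [h2, Finset.mul_sum]
    refine Finset.sum_le_sum fun s _ => ?_
    have h3 := hz s
    have h4 := form_transpose_mul_mul (D s)⁻¹ (D s)⁻¹ (posPart (V s) (Λ s))
      (D s *ᵥ restr (Ω s) *ᵥ u) (D s *ᵥ restr (Ω s) *ᵥ u)
    rw [hDi, mulVec_mulVec _ (D s)⁻¹, Matrix.nonsing_inv_mul _ (hDinv s), one_mulVec] at h4
    rwa [h4, inv_mul_le_iff₀ hτ] at h3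

end StableDecomposition

theorem IsInterpolation.injective {n n0 : ℕ} {V0 : Submodule ℝ (Fin n → ℝ)}
    {R0 : Matrix (Fin n0) (Fin n) ℝ} (h : IsInterpolation V0 R0) :
    Function.Injective R0ᵀ.mulVec :=
  Matrix.mulVec_injective_iff.mpr h.1

/-- `x` in the coarse space and `q` annihilated by the coarse projection are `A`-orthogonal. -/
theorem IsInterpolation.orthogonal {n n0 : ℕ} {V0 : Submodule ℝ (Fin n → ℝ)}
    {R0 : Matrix (Fin n0) (Fin n) ℝ} (h : IsInterpolation V0 R0) {A : Matrix (Fin n) (Fin n) ℝ}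
    (hA : IsUnit (R0 * A * R0ᵀ).det) {x q : Fin n → ℝ} (hx : x ∈ V0)
    (hq : coarseSolve A R0 *ᵥ A *ᵥ q = 0) : x ⬝ᵥ A *ᵥ q = 0 := by
  rw [← h.2] at hx
  obtain ⟨w, rfl⟩ := hx
  rw [mulVecLin_apply, mulVec_transpose, ← dotProduct_mulVec]
  -- Galerkin identity: `R0 * A` is unchanged by right multiplication with the coarse solve times
  -- `A`... applied to `q`, that product is zero.
  have h1 : R0 *ᵥ A *ᵥ q = R0 *ᵥ A *ᵥ coarseSolve A R0 *ᵥ A *ᵥ q := by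
    conv_lhs => rw [← mul_exactSolve hA]
    simp only [mulVec_mulVec, exactSolve, coarseSolve, Matrix.mul_assoc]
  rw [h1, hq, mulVec_zero, mulVec_zero, dotProduct_zero]

end AWG

/-! ### Assembly of the two-level bounds. -/

theorem mainTheorem4 {n N : ℕ}
    -- the matrix, the subdomains, the partition of unity
    (A : Matrix (Fin n) (Fin n) ℝ) (hA : A.PosDef)
    (Ω : Fin N → Finset (Fin n)) (hΩ : ∀ i, ∃ s, i ∈ Ω s)
    (D : (s : Fin N) → Matrix (Ω s) (Ω s) ℝ)
    (hD : AWG.IsPartitionOfUnity Ω D)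
    (hDsymm : ∀ s, (D s).IsSymm) (hDinv : ∀ s, IsUnit (D s).det)
    -- the splitting of `A` into symmetric matrices and their diagonalizations
    (B : (s : Fin N) → Matrix (Ω s) (Ω s) ℝ) (hB : ∀ s, (B s).IsSymm)
    (hAB : A = ∑ s, (AWG.restr (Ω s))ᵀ * B s * AWG.restr (Ω s))
    (V : (s : Fin N) → Matrix (Ω s) (Ω s) ℝ) (Λ : (s : Fin N) → Ω s → ℝ)
    (hV : ∀ s, V s ∈ Matrix.orthogonalGroup (Ω s) ℝ)
    (hBV : ∀ s, B s = V s * Matrix.diagonal (Λ s) * (V s)ᵀ)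
    -- the threshold and the local generalized eigenproblems
    (τ : ℝ) (hτ : 1 < τ)
    (lam : (s : Fin N) → Fin (Fintype.card (Ω s)) → ℝ)
    (y : (s : Fin N) → Fin (Fintype.card (Ω s)) → Ω s → ℝ)
    (hy : ∀ s, AWG.IsPencilEigenbasis
      ((D s)⁻¹ * AWG.posPart (V s) (Λ s) * (D s)⁻¹)
      (AWG.restr (Ω s) * AWG.Apos Ω V Λ * (AWG.restr (Ω s))ᵀ) (lam s) (y s))
    -- the interpolation matrix of the coarse space
    {n0 : ℕ} (R0 : Matrix (Fin n0) (Fin n) ℝ)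
    (hR0 : AWG.IsInterpolation (AWG.coarseSpace Ω τ⁻¹ lam y) R0)
    -- the colouring constant with respect to `A₊`
    (K : ℕ) (hK : AWG.IsColoringConstant Ω (AWG.Apos Ω V Λ) K) :
    (∀ s, IsUnit (AWG.restr (Ω s) * AWG.Apos Ω V Λ * (AWG.restr (Ω s))ᵀ).det) ∧
    IsUnit (R0 * AWG.Apos Ω V Λ * R0ᵀ).det ∧
    AWG.EigenvaluesIn
      (AWG.Hhyb (AWG.Apos Ω V Λ) R0 (AWG.HAS Ω (AWG.Apos Ω V Λ)) * AWG.Apos Ω V Λ)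
      (1 / τ) K ∧
    AWG.EigenvaluesIn
      (AWG.Had (AWG.Apos Ω V Λ) R0 (AWG.HAS Ω (AWG.Apos Ω V Λ)) * AWG.Apos Ω V Λ)
      (1 / ((1 + 2 * (K : ℝ)) * τ)) ((K : ℝ) + 1) := by
  have hAp : (AWG.Apos Ω V Λ).PosDef := AWG.Apos_posDef Ω V Λ (by
    rw [hAB] at hA
    simpa only [hBV] using hA)
  set P := AWG.Apos Ω V Λ with hP
  have hPs := AWG.transpose_eq_of_posDef hAp
  have hR0u : IsUnit (R0 * P * R0ᵀ).det :=
    (AWG.posDef_compress hAp hR0.injective).det_pos.ne'.isUnit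
  refine ⟨fun s => (AWG.posDef_compress hAp
    (AWG.restr_transpose_mulVec_injective _)).det_pos.ne'.isUnit, hR0u, ?_⟩
  -- For `n = 0` the constant `K` may vanish, but the spectrum is empty. Otherwise some subdomain
  -- exists and needs a colour, so `1 ≤ K`.
  rcases Nat.eq_zero_or_pos n with rfl | hn
  · have : ∀ (T : Matrix (Fin 0) (Fin 0) ℝ) (a b : ℝ), AWG.EigenvaluesIn T a b := fun T a b => by
      rw [AWG.EigenvaluesIn, spectrum.of_subsingleton]
      exact Set.empty_subset _
    exact ⟨this _ _ _, this _ _ _⟩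
  have hK1 : (1 : ℝ) ≤ K := by
    obtain ⟨s, -⟩ := hΩ ⟨0, hn⟩
    obtain ⟨C, -, hcov, -⟩ := hK
    obtain ⟨j, -⟩ := Set.mem_iUnion.mp (hcov ▸ Set.mem_univ s : s ∈ ⋃ j, C j)
    exact_mod_cast Nat.succ_le_of_lt (Fin.pos j)
  have hτ0 : 0 < τ := by linarith
  set H := AWG.HAS Ω P with hH
  set Q := AWG.coarseSolve P R0 with hQ
  have hHs : Hᵀ = H := AWG.HAS_transpose Ω hPs
  have hQs : Qᵀ = Q := AWG.exactSolve_transpose hPs R0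
  have hlow : ∀ q, Q *ᵥ P *ᵥ q = 0 → q ⬝ᵥ P *ᵥ q ≤ τ * (q ⬝ᵥ (P * H * P) *ᵥ q) := by
    intro q hq
    obtain ⟨x, hx, z, hxz, hz⟩ :=
      AWG.exists_stable_decomposition Ω hD hDsymm hDinv V Λ hAp hτ0 hy q
    exact AWG.form_le_mul_form_HAS Ω hAp hτ0 (hR0.orthogonal hR0u hx hq) hxz hz
  have hbd := AWG.two_level_form_bounds hAp.posSemidef hQs (AWG.exactSolve_mul_mul hR0u)
    (AWG.posSemidef_mul_HAS_mul Ω hAp) hK1 hτ.le (AWG.form_HAS_le Ω hAp hK) hlow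
  -- Moving `P` across the coarse projector turns it into its transpose, so the hybrid form is the
  -- one-level form evaluated at `(1 - Q * P) *ᵥ u` plus the coarse energy.
  have hhyb : P * (AWG.Hhyb P R0 H * P) =
      (1 - Q * P)ᵀ * (P * H * P) * (1 - Q * P) + P * Q * P := by
    simp only [AWG.Hhyb, AWG.coarseProj, ← hQ, Matrix.transpose_sub, Matrix.transpose_mul,
      Matrix.transpose_one, hQs, hPs]
    noncomm_ring
  have had : P * (AWG.Had P R0 H * P) = P * H * P + P * Q * P := by
    simp only [AWG.Had, ← hQ]
    noncomm_ring
  have hhybf : ∀ u, u ⬝ᵥ (P * (AWG.Hhyb P R0 H * P)) *ᵥ u =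
      ((1 - Q * P) *ᵥ u) ⬝ᵥ (P * H * P) *ᵥ ((1 - Q * P) *ᵥ u) + u ⬝ᵥ (P * Q * P) *ᵥ u := fun u => by
    rw [hhyb, Matrix.add_mulVec, dotProduct_add, AWG.form_transpose_mul_mul]
  have hadf : ∀ u, u ⬝ᵥ (P * (AWG.Had P R0 H * P)) *ᵥ u =
      u ⬝ᵥ (P * H * P) *ᵥ u + u ⬝ᵥ (P * Q * P) *ᵥ u := fun u => by
    rw [had, Matrix.add_mulVec, dotProduct_add]
  constructor
  · refine AWG.eigenvaluesIn_of_form_bounds hAp ?_ (fun u => ?_) fun u => ?_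
    · rw [hhyb]
      simp only [Matrix.transpose_add, Matrix.transpose_mul, Matrix.transpose_transpose, hPs, hQs,
        hHs, Matrix.mul_assoc]
    · rw [hhybf]
      exact (hbd u).1.1
    · rw [hhybf]
      exact (hbd u).1.2
  · refine AWG.eigenvaluesIn_of_form_bounds hAp ?_ (fun u => ?_) fun u => ?_
    · rw [had]
      simp only [Matrix.transpose_add, Matrix.transpose_mul, hPs, hQs, hHs, Matrix.mul_assoc]
    · rw [hadf]
      exact (hbd u).2.1
    · rw [hadf]
      exact (hbd u).2.2
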